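/- Let $d\ge 2$. Let $\mathbb R^{d,1}$ be $\mathbb R^{d+1}$ with the form $\langle x,y\rangle=x_1y_1+\dots+x_dy_d-x_{d+1}y_{d+1}$, let $\mathbb H^d=\{x : \langle x,x\rangle=-1,\ x_{d+1}>0\}$ be hyperbolic space, and let $O_+(d,1)$ be the group of linear maps that preserve the form and $\mathbb H^d$. Let $\Gamma\subset O_+(d,1)$ be a subgroup that acts freely and properly discontinuously on $\mathbb H^d$ with compact quotient, so that $\mathbb H^d/\Gamma$ is a compact hyperbolic manifold. Let $H^1(\Gamma,\mathbb R^{d,1})$ be the quotient of the space of cocycles, i.e. maps $\tau:\Gamma\to\mathbb R^{d,1}$ with $\tau(AB)=\tau(A)+A\,\tau(B)$, by the space of coboundaries $A\mapsto Av-v$, $v\in\mathbb R^{d,1}$. Suppose that $\mathbb H^d/\Gamma$ contains $n$ pairwise disjoint embedded totally geodesic hypersurfaces $H_1,\dots,H_n$, where a hypersurface is non-empty and closed (hence compact, without boundary); that is, the preimage of each $H_i$ in $\mathbb H^d$ coincides near each of its points with a totally geodesic hyperplane. Then $$\dim_{\mathbb R} H^1(\Gamma,\mathbb R^{d,1})\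 \ge\ n .$$ More precisely, fix any base point $x\in\mathbb H^d$ whose image in $\mathbb H^d/\Gamma$ lies on none of the $H_i$. A lift of $H_i$ is a totally geodesic hyperplane $l\subset\mathbb H^d$ contained in the preimage of $H_i$. For weights $\omega=(\omega_1,\dots,\omega_n)\in\mathbb R^n$ and $A\in\Gamma$ put $$\tau_\omega(A)=\sum_{i=1}^n\ \omega_i\sum_{l} v_l ,$$ where the inner (finite) sum runs over the lifts $l$ of $H_i$ that separate $x$ from $Ax$, equivalently those that are crossed by the geodesic from $x$ to $Ax$, and $v_l\in\mathbb R^{d,1}$ is the unit spacelike normal of $l$ pointing to the side of $Ax$. Then every $\tau_\omega$ is a cocycle, and the linear map $\omega\mapsto[\tau_\omega]$ from $\mathbb R^n$ to $H^1(\Gamma,\mathbb R^{d,1})$ is injective. -/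

import Mathlib

noncomputable section

namespace HypCocycle

/-- The vector space `ℝ^{d+1}` underlying Minkowski space `ℝ^{d,1}`. -/
abbrev Mink (d : ℕ) : Type := Fin (d + 1) → ℝ

/-- The Lorentzian form `x₁y₁ + ⋯ + x_d y_d - x_{d+1} y_{d+1}`. -/
def form {d : ℕ} (x y : Mink d) : ℝ :=
  (∑ i : Fin d, x i.castSucc * y i.castSucc) - x (Fin.last d) * y (Fin.last d)

/-- The hyperboloid `{x | ⟨x,x⟩ = -1, x_{d+1} > 0}`. -/
def hyperboloid (d : ℕ) : Set (Mink d) :=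
  {x | form x x = -1 ∧ 0 < x (Fin.last d)}

/-- Hyperbolic space `ℍ^d` in the hyperboloid model, with the topology induced by `ℝ^{d+1}`. -/
abbrev Hyp (d : ℕ) : Type := hyperboloid d

/-- The group `O₊(d,1)` of linear automorphisms of `ℝ^{d+1}` that preserve the Lorentzian form
and the hyperboloid; it is the isometry group of `ℍ^d`. -/
def OPlus (d : ℕ) : Subgroup (Mink d ≃ₗ[ℝ] Mink d) where
  carrier := {A | (∀ x y, form (A x) (A y) = form x y) ∧
    ∀ x, A x ∈ hyperboloid d ↔ x ∈ hyperboloid d}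
  mul_mem' := by
    rintro A B ⟨hA, hA'⟩ ⟨hB, hB'⟩
    refine ⟨fun x y => ?_, fun x => ?_⟩
    · rw [LinearEquiv.mul_apply, LinearEquiv.mul_apply, hA, hB]
    · rw [LinearEquiv.mul_apply, hA', hB']
  one_mem' := ⟨fun _ _ => rfl, fun _ => Iff.rfl⟩
  inv_mem' := by
    rintro A ⟨hA, hA'⟩
    have h : ∀ x, A (A⁻¹ x) = x := fun x => A.apply_symm_apply x
    refine ⟨fun x y => ?_, fun x => ?_⟩
    · rw [← hA, h, h]
    · rw [← hA', h]

/-- The isometric action of a subgroup of `O₊(d,1)` on `ℍ^d`. -/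
instance hypAction {d : ℕ} (Γ : Subgroup (OPlus d)) : MulAction Γ (Hyp d) where
  smul A x := ⟨A.1.1 x.1, (A.1.2.2 x.1).2 x.2⟩
  one_smul _ := rfl
  mul_smul _ _ _ := rfl

/-- The quotient `ℍ^d/Γ`, with the quotient topology. -/
abbrev HypQuotient {d : ℕ} (Γ : Subgroup (OPlus d)) : Type :=
  Quotient (MulAction.orbitRel Γ (Hyp d))

/-- The projection `ℍ^d → ℍ^d/Γ`. -/
def proj {d : ℕ} (Γ : Subgroup (OPlus d)) (x : Hyp d) : HypQuotient Γ :=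
  Quotient.mk _ x

/-- `ℍ^d/Γ` is a compact hyperbolic manifold: `Γ` acts freely and properly discontinuously on
`ℍ^d`, and the quotient is compact. -/
structure IsCompactHyperbolicManifold {d : ℕ} (Γ : Subgroup (OPlus d)) : Prop where
  free : ∀ (A : Γ) (x : Hyp d), A • x = x → A = 1
  properlyDiscontinuous : ProperlyDiscontinuousSMul Γ (Hyp d)
  compact : CompactSpace (HypQuotient Γ)

/-- The totally geodesic hyperplane of `ℍ^d` orthogonal to `v`, for a unit spacelike `v`. -/
def hyperplane {d : ℕ} (v : Mink d) : Set (Hyp d) :=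
  {x | form x.1 v = 0}

/-- `S` is a (non-empty, closed) embedded totally geodesic hypersurface of `ℍ^d/Γ`: it is a
closed subset and, in `ℍ^d`, which covers `ℍ^d/Γ` locally isometrically, it coincides near each of
its points with a totally geodesic hyperplane. It need be neither connected nor two-sided. -/
structure IsTotallyGeodesicHypersurface {d : ℕ} (Γ : Subgroup (OPlus d))
    (S : Set (HypQuotient Γ)) : Prop where
  nonempty : S.Nonempty
  isClosed : IsClosed S
  locally_hyperplane : ∀ x : Hyp d, proj Γ x ∈ S →
    ∃ v : Mink d, form v v = 1 ∧
      ∃ U : Set (Hyp d), IsOpen U ∧ x ∈ U ∧ proj Γ ⁻¹' S ∩ U = hyperplane v ∩ U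

/-- The unit spacelike vectors `v` such that `hyperplane v` is a lift of (a component of) `S`
that separates `x` from `y`, and `v` is its unit normal pointing to the side of `y`. Every
separating lift has exactly one such `v`. A geodesic from `x` to `y`, neither of which
is on a lift, crosses exactly the separating lifts, each of them once and transversally. -/
def crossedNormals {d : ℕ} (Γ : Subgroup (OPlus d)) (S : Set (HypQuotient Γ)) (x y : Hyp d) :
    Set (Mink d) :=
  {v | form v v = 1 ∧ hyperplane v ⊆ proj Γ ⁻¹' S ∧ form x.1 v < 0 ∧ 0 < form y.1 v}

/-- The sum of the unit normals, in the direction of travel, of the lifts of `S` that are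
crossed on the way from `x` to `y`. -/
def crossing {d : ℕ} (Γ : Subgroup (OPlus d)) (S : Set (HypQuotient Γ)) (x y : Hyp d) : Mink d :=
  ∑ᶠ v ∈ crossedNormals Γ S x y, v

/-- The standard linear representation of `Γ` on `ℝ^{d,1}`. -/
def minkRepresentation {d : ℕ} (Γ : Subgroup (OPlus d)) : Representation ℝ Γ (Mink d) where
  toFun A := (A.1.1 : Mink d →ₗ[ℝ] Mink d)
  map_one' := rfl
  map_mul' _ _ := rfl

/-- The `Γ`-module `ℝ^{d,1}`. -/
abbrev minkRep {d : ℕ} (Γ : Subgroup (OPlus d)) : Rep ℝ Γ :=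
  Rep.of (minkRepresentation Γ)

end HypCocycle

end

/-! If the weighted crossing cocycle is the coboundary `A ↦ A w - w`, consider `potential`, the
function f(y) = ⟨y, c(y) + w⟩ on hyperbolic space, where c(y) is the weighted sum of normals crossed
from x to y. Crossing a lift changes c by a multiple of its normal, which is orthogonal to every y
on that lift; so f is continuous, and off the lifts it is locally the restriction of a linear
functional. The coboundary equation makes f invariant under Γ (`potential_smul`), hence bounded with
an attained maximum, because the quotient is compact.

Since the lifts are disjoint, c is constant along each one, so on a lift f is a bounded linear
functional. Along a geodesic such a functional has the form a cosh s + b sinh s, so it vanishes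
(`potential_eq_zero_of_mem_hyperplane`). A positive maximum would then lie off the lifts, where a
linear functional is strictly convex along geodesics wherever it is positive (`potential_nonpos`).
The same argument for -f gives f = 0. But f has a kink of size proportional to `ω i` across each
lift of `H i`, so all weights vanish (`weight_eq_zero_of_potential_eq_zero`). -/

namespace HypCocycle

variable {d : ℕ}

/-! ### The Lorentzian form. -/

lemma form_comm (x y : Mink d) : form x y = form y x := by
  simp only [form, mul_comm]

lemma form_add_left (x y z : Mink d) : form (x + y) z = form x z + form y z := by
  simp only [form, Pi.add_apply, add_mul, Finset.sum_add_distrib]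
  ring

lemma form_smul_left (c : ℝ) (x z : Mink d) : form (c • x) z = c * form x z := by
  simp only [form, Pi.smul_apply, smul_eq_mul, mul_assoc, ← Finset.mul_sum]
  ring

/-- The Lorentzian form as a bilinear map. -/
noncomputable def formBilin (d : ℕ) : Mink d →ₗ[ℝ] Mink d →ₗ[ℝ] ℝ :=
  LinearMap.mk₂ ℝ form form_add_left form_smul_left
    (fun x y z => by rw [form_comm, form_add_left, form_comm y, form_comm z])
    (fun c x y => by rw [form_comm, form_smul_left, form_comm y, smul_eq_mul])

@[simp] lemma formBilin_apply (x y : Mink d) : formBilin d x y = form x y := rfl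

lemma form_add_right (x y z : Mink d) : form x (y + z) = form x y + form x z :=
  (formBilin d x).map_add y z

lemma form_smul_right (c : ℝ) (x y : Mink d) : form x (c • y) = c * form x y :=
  (formBilin d x).map_smul c y

lemma form_neg_left (x y : Mink d) : form (-x) y = -form x y :=
  (formBilin d).map_neg₂ x y

lemma form_neg_right (x y : Mink d) : form x (-y) = -form x y :=
  (formBilin d x).map_neg y

lemma form_sub_left (x y z : Mink d) : form (x - y) z = form x z - form y z :=
  (formBilin d).map_sub₂ x y z

lemma form_sub_right (x y z : Mink d) : form x (y - z) = form x y - form x z :=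
  (formBilin d x).map_sub y z

@[fun_prop]
lemma continuous_form {X : Type*} [TopologicalSpace X] {f g : X → Mink d}
    (hf : Continuous f) (hg : Continuous g) : Continuous fun a => form (f a) (g a) := by
  unfold HypCocycle.form
  fun_prop

/-- By Cauchy–Schwarz, the form is positive definite on the orthogonal complement of a timelike
vector. -/
lemma eq_zero_of_form_eq_zero {y q : Mink d} (hy : form y y < 0) (hqy : form q y = 0)
    (hq : form q q ≤ 0) : q = 0 := by
  have cs := Finset.sum_mul_sq_le_sq_mul_sq Finset.univ
    (fun i : Fin d => q i.castSucc) (fun i => y i.castSucc)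
  simp only [form, ← sq] at hy hqy hq
  rw [sub_eq_zero.1 hqy] at cs
  have hS : 0 ≤ ∑ i : Fin d, y i.castSucc ^ 2 := Finset.sum_nonneg fun _ _ => sq_nonneg _
  have hT : 0 ≤ ∑ i : Fin d, q i.castSucc ^ 2 := Finset.sum_nonneg fun _ _ => sq_nonneg _
  have h0 : q (Fin.last d) = 0 := by
    by_contra h
    have : 0 < q (Fin.last d) ^ 2 := by positivity
    nlinarith
  rw [h0] at hq
  have hT0 : ∑ i : Fin d, q i.castSucc ^ 2 = 0 := le_antisymm (by linarith) hT
  rw [Finset.sum_eq_zero_iff_of_nonneg fun _ _ => sq_nonneg _] at hT0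
  funext j
  refine Fin.lastCases h0 (fun i => ?_) j
  simpa using hT0 i (Finset.mem_univ _)

/-! ### The future cone and its radial projection to hyperbolic space. -/

/-- The open cone of future-directed timelike vectors. -/
def futureCone (d : ℕ) : Set (Mink d) := {z | form z z < 0 ∧ 0 < z (Fin.last d)}

lemma isOpen_futureCone : IsOpen (futureCone d) :=
  (isOpen_lt (f := fun z : Mink d => form z z) (by fun_prop) continuous_const).inter
    (isOpen_lt (g := fun z : Mink d => z (Fin.last d)) continuous_const (by fun_prop))

lemma form_neg_of_mem_futureCone {y z : Mink d} (hy : y ∈ futureCone d) (hz : z ∈ futureCone d) :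
    form y z < 0 := by
  obtain ⟨hy, hy'⟩ := hy
  obtain ⟨hz, hz'⟩ := hz
  have cs := Finset.sum_mul_sq_le_sq_mul_sq Finset.univ
    (fun i : Fin d => y i.castSucc) (fun i => z i.castSucc)
  simp only [form, ← sq] at hy hz ⊢
  have hS : 0 ≤ ∑ i : Fin d, z i.castSucc ^ 2 := Finset.sum_nonneg fun _ _ => sq_nonneg _
  have : (∑ i : Fin d, y i.castSucc * z i.castSucc) < y (Fin.last d) * z (Fin.last d) := by
    refine lt_of_pow_lt_pow_left₀ 2 (by positivity) ?_
    have : 0 < y (Fin.last d) ^ 2 := by positivity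
    nlinarith
  linarith

lemma smul_mem_futureCone {c : ℝ} (hc : 0 < c) {z : Mink d} (hz : z ∈ futureCone d) :
    c • z ∈ futureCone d := by
  refine ⟨?_, by simpa using mul_pos hc hz.2⟩
  rw [form_smul_left, form_smul_right]
  have := hz.1
  have : 0 < c * c := by positivity
  nlinarith

lemma add_mem_futureCone {y z : Mink d} (hy : y ∈ futureCone d) (hz : z ∈ futureCone d) :
    y + z ∈ futureCone d := by
  refine ⟨?_, add_pos hy.2 hz.2⟩
  have h := form_neg_of_mem_futureCone hy hz
  rw [form_add_left, form_add_right, form_add_right, form_comm z y]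
  linarith [hy.1, hz.1]

lemma convex_futureCone : Convex ℝ (futureCone d) := by
  refine convex_iff_forall_pos.2 fun y hy z hz a b ha hb _ => ?_
  exact add_mem_futureCone (smul_mem_futureCone ha hy) (smul_mem_futureCone hb hz)

lemma Hyp.form_self (y : Hyp d) : form y.1 y.1 = -1 := y.2.1

lemma Hyp.mem_futureCone (y : Hyp d) : y.1 ∈ futureCone d :=
  ⟨by rw [y.form_self]; norm_num, y.2.2⟩

/-- The radial projection of the future cone to hyperbolic space. -/
noncomputable def toHyp (z : futureCone d) : Hyp d :=
  ⟨(√(-form z.1 z.1))⁻¹ • z.1, by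
    have h : 0 < -form z.1 z.1 := neg_pos.2 z.2.1
    refine ⟨?_, ?_⟩
    · rw [form_smul_left, form_smul_right, ← mul_assoc, ← mul_inv, Real.mul_self_sqrt h.le]
      have := h.ne'
      rw [neg_ne_zero] at this
      field_simp
    · have := z.2.2
      have := Real.sqrt_pos.2 h
      simp only [Pi.smul_apply, smul_eq_mul]
      positivity⟩

lemma continuous_toHyp : Continuous (toHyp (d := d)) := by
  refine Continuous.subtype_mk ?_ _
  have h : Continuous fun z : futureCone d => √(-form z.1 z.1) := by fun_prop
  refine (h.inv₀ fun z => ?_).smul continuous_subtype_val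
  exact (Real.sqrt_pos.2 (neg_pos.2 z.2.1)).ne'

lemma sqrt_smul_toHyp (z : futureCone d) : √(-form z.1 z.1) • (toHyp z).1 = z.1 :=
  smul_inv_smul₀ (Real.sqrt_pos.2 (neg_pos.2 z.2.1)).ne' _

lemma toHyp_coe (y : Hyp d) : toHyp ⟨y.1, y.mem_futureCone⟩ = y := by
  refine Subtype.ext ?_
  simp [toHyp, y.form_self]

lemma form_eq_sqrt_mul (z : futureCone d) (v : Mink d) :
    form z.1 v = √(-form z.1 z.1) * form (toHyp z).1 v := by
  rw [← form_smul_left, sqrt_smul_toHyp]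

lemma form_toHyp_eq_zero_iff (z : futureCone d) (v : Mink d) :
    form (toHyp z).1 v = 0 ↔ form z.1 v = 0 := by
  rw [form_eq_sqrt_mul, mul_eq_zero, or_iff_right]
  exact (Real.sqrt_pos.2 (neg_pos.2 z.2.1)).ne'

/-- Every vector near a point of hyperbolic space is a multiple of a nearby point. -/
lemma eventually_toHyp_mem {y : Hyp d} {U : Set (Hyp d)} (hU : U ∈ nhds y) :
    ∀ᶠ z in nhds y.1, ∃ h : z ∈ futureCone d, toHyp ⟨z, h⟩ ∈ U := by
  have h1 : toHyp ⁻¹' U ∈ nhds (⟨y.1, y.mem_futureCone⟩ : futureCone d) :=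
    continuous_toHyp.continuousAt (by rwa [toHyp_coe])
  rw [isOpen_futureCone.isOpenEmbedding_subtypeVal.isInducing.nhds_eq_comap,
    Filter.mem_comap] at h1
  obtain ⟨W, hW, hWU⟩ := h1
  filter_upwards [hW, isOpen_futureCone.mem_nhds y.mem_futureCone] with z hz hz'
  exact ⟨hz', hWU hz⟩

lemma tendsto_add_smul (y q : Mink d) :
    Filter.Tendsto (fun t : ℝ => y + t • q) (nhds 0) (nhds y) := by
  have : Continuous fun t : ℝ => y + t • q := by fun_prop
  simpa using this.tendsto 0

/-! ### Geodesic segments and hyperplanes. -/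

/-- The points of the geodesic segment between two points of hyperbolic space. -/
noncomputable def segPoint (t : unitInterval) (y z : Hyp d) : Hyp d :=
  toHyp ⟨(1 - t : ℝ) • y.1 + (t : ℝ) • z.1,
    convex_futureCone y.mem_futureCone z.mem_futureCone (sub_nonneg.2 t.2.2) t.2.1 (by ring)⟩

lemma continuous_segPoint :
    Continuous fun p : unitInterval × Hyp d × Hyp d => segPoint p.1 p.2.1 p.2.2 :=
  continuous_toHyp.comp (Continuous.subtype_mk (by fun_prop) _)

lemma continuous_segPoint_left (y z : Hyp d) : Continuous fun t => segPoint t y z :=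
  continuous_segPoint.comp (f := fun t => (t, y, z)) (by fun_prop)

lemma form_segPoint_eq_zero_iff (t : unitInterval) (y z : Hyp d) (v : Mink d) :
    form (segPoint t y z).1 v = 0 ↔ (1 - t : ℝ) * form y.1 v + t * form z.1 v = 0 := by
  rw [segPoint, form_toHyp_eq_zero_iff, form_add_left, form_smul_left, form_smul_left]

@[simp] lemma segPoint_zero (y z : Hyp d) : segPoint 0 y z = y := by
  simp [segPoint, toHyp_coe]

@[simp] lemma segPoint_one (y z : Hyp d) : segPoint 1 y z = z := by
  simp [segPoint, toHyp_coe]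

lemma segPoint_mem_hyperplane {v : Mink d} {y z : Hyp d} (hy : y ∈ hyperplane v)
    (hz : z ∈ hyperplane v) (t : unitInterval) : segPoint t y z ∈ hyperplane v := by
  have hy : form y.1 v = 0 := hy
  have hz : form z.1 v = 0 := hz
  simp [hyperplane, form_segPoint_eq_zero_iff, hy, hz]

lemma exists_segPoint_mem_hyperplane {v : Mink d} {y z : Hyp d} (hy : form y.1 v ≤ 0)
    (hz : 0 ≤ form z.1 v) : ∃ t, segPoint t y z ∈ hyperplane v := by
  have h : Continuous fun t : unitInterval => form (segPoint t y z).1 v :=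
    continuous_form (continuous_subtype_val.comp (continuous_segPoint_left y z)) continuous_const
  obtain ⟨t, ht⟩ := mem_range_of_exists_le_of_exists_ge h ⟨0, by simpa using hy⟩
    ⟨1, by simpa using hz⟩
  exact ⟨t, ht⟩

lemma isPreconnected_hyperplane (v : Mink d) : IsPreconnected (hyperplane v) := by
  refine isPreconnected_of_forall_pair fun y hy z hz => ?_
  refine ⟨Set.range fun t => segPoint t y z, ?_, ⟨0, by simp⟩, ⟨1, by simp⟩,
    isPreconnected_range (continuous_segPoint_left y z)⟩
  rintro _ ⟨t, rfl⟩
  exact segPoint_mem_hyperplane hy hz t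

@[simp] lemma hyperplane_neg (v : Mink d) : hyperplane (-v) = hyperplane v := by
  ext; simp [hyperplane, form_neg_right]

/-- Two linear conditions cannot cut a space of dimension d + 1 ≥ 3 down to zero. This supplies a
geodesic through y inside the hyperplane of v. -/
lemma exists_ne_zero_form_eq_zero (hd : 2 ≤ d) (y v : Mink d) :
    ∃ q : Mink d, q ≠ 0 ∧ form q y = 0 ∧ form q v = 0 := by
  let f : Mink d →ₗ[ℝ] ℝ × ℝ := (formBilin d y).prod (formBilin d v)
  have h : LinearMap.ker f ≠ ⊥ := LinearMap.ker_ne_bot_of_finrank_lt (by simp; omega)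
  obtain ⟨q, hq, hq0⟩ := Submodule.exists_mem_ne_zero_of_ne_bot h
  have : form y q = 0 ∧ form v q = 0 := by simpa [f] using hq
  exact ⟨q, hq0, by rw [form_comm, this.1], by rw [form_comm, this.2]⟩

lemma exists_unit_form_eq_zero (hd : 2 ≤ d) (y : Hyp d) (v : Mink d) :
    ∃ q : Mink d, form q q = 1 ∧ form q y.1 = 0 ∧ form q v = 0 := by
  obtain ⟨q, hq, hqy, hqv⟩ := exists_ne_zero_form_eq_zero hd y.1 v
  have h : 0 < form q q := by
    by_contra! h
    exact hq (eq_zero_of_form_eq_zero y.mem_futureCone.1 hqy h)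
  refine ⟨(√(form q q))⁻¹ • q, ?_, ?_, ?_⟩
  · rw [form_smul_left, form_smul_right, ← mul_assoc, ← mul_inv, Real.mul_self_sqrt h.le,
      inv_mul_cancel₀ h.ne']
  · rw [form_smul_left, hqy, mul_zero]
  · rw [form_smul_left, hqv, mul_zero]

/-- Hyperplanes that agree near a common point are equal. -/
lemma eq_or_eq_neg_of_hyperplane_inter_subset {u v : Mink d} (hu : form u u = 1)
    (hv : form v v = 1) {y : Hyp d} (hy : y ∈ hyperplane v) {U : Set (Hyp d)} (hU : U ∈ nhds y)
    (h : hyperplane v ∩ U ⊆ hyperplane u) : u = v ∨ u = -v := by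
  have hyv : form y.1 v = 0 := hy
  have hyu : form y.1 u = 0 := h ⟨hy, mem_of_mem_nhds hU⟩
  -- q is the part of u orthogonal to v, hence tangent at y to the hyperplane of v. Moving y along q
  -- stays in that hyperplane, so also in that of u; this makes q orthogonal to u, hence null, and a
  -- null vector orthogonal to the timelike y is zero.
  set q := u - form u v • v with hq
  have hqv : form q v = 0 := by rw [hq, form_sub_left, form_smul_left, hv]; ring
  have hqy : form q y.1 = 0 := by
    rw [hq, form_sub_left, form_smul_left, form_comm u, form_comm v, hyv, hyu]; ring
  have hqu : form q u = 0 := by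
    have h1 := (tendsto_add_smul y.1 q).eventually (eventually_toHyp_mem hU)
    have h2 := (h1.filter_mono nhdsWithin_le_nhds).and 
      (self_mem_nhdsWithin : {(0 : ℝ)}ᶜ ∈ nhdsWithin 0 {0}ᶜ)
    obtain ⟨t, ⟨hc, ht⟩, ht0⟩ := h2.exists
    have h3 : toHyp ⟨y.1 + t • q, hc⟩ ∈ hyperplane v := by
      refine (form_toHyp_eq_zero_iff _ _).2 ?_
      simp [form_add_left, form_smul_left, hyv, hqv]
    have h4 : form (y.1 + t • q) u = 0 := (form_toHyp_eq_zero_iff _ _).1 (h ⟨h3, ht⟩)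
    rw [form_add_left, form_smul_left, hyu, zero_add] at h4
    exact (mul_eq_zero.1 h4).resolve_left ht0
  have hqq : form q q = 0 := by
    conv_lhs => rw [hq]
    rw [form_comm, form_sub_right, form_smul_right, ← hq, hqu, hqv]; ring
  have hq0 := eq_zero_of_form_eq_zero y.mem_futureCone.1 hqy hqq.le
  have huv : u = form u v • v := sub_eq_zero.1 hq0
  have h1 : form u v * form u v = 1 := by
    nth_rw 2 [huv] at hu
    rwa [form_smul_right] at hu
  rcases mul_self_eq_one_iff.1 h1 with h | h
  · left; rw [huv, h, one_smul]
  · right; rw [huv, h, neg_one_smul]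

end HypCocycle

namespace HypCocycle

open Filter Topology

variable {d : ℕ} {Γ : Subgroup (OPlus d)} {S : Set (HypQuotient Γ)}

/-! ### Lifts of a hypersurface: existence, disjointness, local finiteness. -/

/-- The unit normals of the lifts of `S`. -/
def liftNormals {d : ℕ} (Γ : Subgroup (OPlus d)) (S : Set (HypQuotient Γ)) : Set (Mink d) :=
  {v | form v v = 1 ∧ hyperplane v ⊆ proj Γ ⁻¹' S}

lemma neg_mem_liftNormals {v : Mink d} (hv : v ∈ liftNormals Γ S) : -v ∈ liftNormals Γ S :=
  ⟨by rw [form_neg_left, form_neg_right, neg_neg, hv.1], by rw [hyperplane_neg]; exact hv.2⟩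

lemma continuous_proj : Continuous (proj Γ) := continuous_quotient_mk'

@[simp] lemma proj_smul (A : Γ) (x : Hyp d) : proj Γ (A • x) = proj Γ x :=
  Quotient.sound ⟨A, rfl⟩

lemma form_ne_zero_of_proj_notMem {x : Hyp d} (hx : proj Γ x ∉ S) {v : Mink d}
    (hv : v ∈ liftNormals Γ S) : form x.1 v ≠ 0 := fun h => hx (hv.2 h)

lemma IsTotallyGeodesicHypersurface.exists_nhds (hS : IsTotallyGeodesicHypersurface Γ S)
    {x : Hyp d} (hx : proj Γ x ∈ S) :
    ∃ v : Mink d, form v v = 1 ∧ x ∈ hyperplane v ∧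
      ∃ U ∈ 𝓝 x, proj Γ ⁻¹' S ∩ U = hyperplane v ∩ U := by
  obtain ⟨v, hv, U, hU, hxU, h⟩ := hS.locally_hyperplane x hx
  exact ⟨v, hv, (h.subset ⟨hx, hxU⟩).1, U, hU.mem_nhds hxU, h⟩

/-- Near a common point both lifts coincide with the one local hyperplane that is the preimage of
`S`; embeddedness thus forbids crossings. -/
lemma eq_or_eq_neg_of_mem_hyperplane (hS : IsTotallyGeodesicHypersurface Γ S) {v w : Mink d}
    (hv : v ∈ liftNormals Γ S) (hw : w ∈ liftNormals Γ S) {y : Hyp d} (hyv : y ∈ hyperplane v)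
    (hyw : y ∈ hyperplane w) : w = v ∨ w = -v := by
  obtain ⟨u, hu, hyu, U, hU, h⟩ := hS.exists_nhds (hv.2 hyv)
  have h1 := eq_or_eq_neg_of_hyperplane_inter_subset hu hv.1 hyv hU fun z hz =>
    (h.subset ⟨hv.2 hz.1, hz.2⟩).1
  have h2 := eq_or_eq_neg_of_hyperplane_inter_subset hu hw.1 hyw hU fun z hz =>
    (h.subset ⟨hw.2 hz.1, hz.2⟩).1
  rcases h1 with rfl | rfl <;> rcases h2 with h2 | h2 <;> simp_all

/-- The hyperplane that agrees with the preimage of `S` near one point lies in this preimage. -/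
lemma mem_liftNormals_of_nhds (hS : IsTotallyGeodesicHypersurface Γ S) {v : Mink d}
    (hv : form v v = 1) {x : Hyp d} (hx : x ∈ hyperplane v) {U : Set (Hyp d)} (hU : U ∈ 𝓝 x)
    (h : proj Γ ⁻¹' S ∩ U = hyperplane v ∩ U) : v ∈ liftNormals Γ S := by
  refine ⟨hv, ?_⟩
  have : PreconnectedSpace (hyperplane v) :=
    isPreconnected_iff_preconnectedSpace.1 (isPreconnected_hyperplane v)
  have hP : IsClosed (proj Γ ⁻¹' S) := hS.isClosed.preimage continuous_proj
  -- Continuation along the hyperplane: the points where it agrees locally with the preimage form a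
  -- clopen subset of a connected set. Closedness uses that the local hyperplane at a limit point
  -- agrees with that of v near some point of `T`.
  let T : Set (hyperplane v) := {z | ∀ᶠ y in 𝓝 z.1, y ∈ proj Γ ⁻¹' S ↔ y ∈ hyperplane v}
  have hTS : ∀ z ∈ T, z.1 ∈ proj Γ ⁻¹' S := fun z hz => (Eventually.self_of_nhds hz).2 z.2
  have hTo : IsOpen T := by
    have : IsOpen {z : Hyp d | ∀ᶠ y in 𝓝 z, y ∈ proj Γ ⁻¹' S ↔ y ∈ hyperplane v} :=
      isOpen_setOfPred_eventually_nhds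
    exact this.preimage continuous_subtype_val
  have hTc : IsClosed T := by
    refine isClosed_of_closure_subset fun z hz => ?_
    have hzS : z.1 ∈ proj Γ ⁻¹' S :=
      closure_minimal hTS (hP.preimage continuous_subtype_val) hz
    obtain ⟨u, hu, hzu, W, hW, hWu⟩ := hS.exists_nhds hzS
    obtain ⟨W', hW'W, hW'o, hzW'⟩ := mem_nhds_iff.1 hW
    obtain ⟨z', hz'W, hz'T⟩ := mem_closure_iff.1 hz _ (hW'o.preimage continuous_subtype_val) hzW'
    have huv : u = v ∨ u = -v := by
      refine eq_or_eq_neg_of_hyperplane_inter_subset hu hv z'.2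
        (inter_mem hz'T (hW'o.mem_nhds hz'W)) fun y hy => ?_
      exact (hWu.subset ⟨hy.2.1.2 hy.1, hW'W hy.2.2⟩).1
    have huv' : hyperplane u = hyperplane v := by
      rcases huv with rfl | rfl <;> simp
    filter_upwards [hW] with y hy
    rw [huv'] at hWu
    exact ⟨fun h => (hWu.subset ⟨h, hy⟩).1, fun h => (hWu.superset ⟨h, hy⟩).1⟩
  have hT : T = Set.univ := by
    refine IsClopen.eq_univ ⟨hTc, hTo⟩ ⟨⟨x, hx⟩, ?_⟩
    filter_upwards [hU] with y hy
    exact ⟨fun h' => (h.subset ⟨h', hy⟩).1, fun h' => (h.superset ⟨h', hy⟩).1⟩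
  intro z hz
  exact hTS ⟨z, hz⟩ (hT ▸ Set.mem_univ _)

lemma exists_mem_liftNormals (hS : IsTotallyGeodesicHypersurface Γ S) {x : Hyp d}
    (hx : proj Γ x ∈ S) : ∃ v ∈ liftNormals Γ S, x ∈ hyperplane v := by
  obtain ⟨v, hv, hxv, U, hU, h⟩ := hS.exists_nhds hx
  exact ⟨v, mem_liftNormals_of_nhds hS hv hxv hU h, hxv⟩

lemma finite_liftNormals_inter (hS : IsTotallyGeodesicHypersurface Γ S) {K : Set (Hyp d)}
    (hK : IsCompact K) : {v ∈ liftNormals Γ S | (hyperplane v ∩ K).Nonempty}.Finite := by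
  refine hK.induction_on (p := fun K => {v ∈ liftNormals Γ S | (hyperplane v ∩ K).Nonempty}.Finite)
    (by simp) (fun s t hst ht => ?_) (fun s t hs ht => ?_) fun x _ => ?_
  · exact ht.subset fun v hv => ⟨hv.1, hv.2.mono (Set.inter_subset_inter_right _ hst)⟩
  · refine (hs.union ht).subset fun v hv => ?_
    rcases hv with ⟨hv, y, hy, hy' | hy'⟩
    exacts [Or.inl ⟨hv, y, hy, hy'⟩, Or.inr ⟨hv, y, hy, hy'⟩]
  by_cases hx : proj Γ x ∈ S
  · obtain ⟨u, hu, hxu, U, hU, h⟩ := hS.exists_nhds hx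
    obtain ⟨W, hWU, hW, hxW⟩ := mem_nhds_iff.1 hU
    refine ⟨W, mem_nhdsWithin_of_mem_nhds (hW.mem_nhds hxW),
      (Set.toFinite {u, -u}).subset ?_⟩
    rintro v ⟨hv, y, hy, hyW⟩
    rcases eq_or_eq_neg_of_hyperplane_inter_subset hu hv.1 hy (hW.mem_nhds hyW) fun z hz =>
      (h.subset ⟨hv.2 hz.1, hWU hz.2⟩).1 with rfl | rfl <;> simp
  · refine ⟨(proj Γ ⁻¹' S)ᶜ, mem_nhdsWithin_of_mem_nhds
      ((hS.isClosed.preimage continuous_proj).isOpen_compl.mem_nhds hx),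
      Set.finite_empty.subset ?_⟩
    rintro v ⟨hv, y, hy, hyW⟩
    exact hyW (hv.2 hy)

/-- A lift that separates x from a point of `K`, or passes through that point, meets the compact
union of segments from x to `K`. The weak inequality keeps the lifts through y itself, which carry
the kinks of the potential. -/
lemma exists_finset_forall_mem (hS : IsTotallyGeodesicHypersurface Γ S) (x : Hyp d)
    {K : Set (Hyp d)} (hK : IsCompact K) :
    ∃ F : Finset (Mink d), ↑F ⊆ liftNormals Γ S ∧
      ∀ y ∈ K, ∀ v ∈ liftNormals Γ S, form x.1 v < 0 → 0 ≤ form y.1 v → v ∈ F := by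
  have hf : Continuous fun p : unitInterval × Hyp d => segPoint p.1 x p.2 :=
    continuous_segPoint.comp (f := fun p : unitInterval × Hyp d => (p.1, x, p.2)) (by fun_prop)
  have hfin := finite_liftNormals_inter hS ((isCompact_univ.prod hK).image hf)
  refine ⟨hfin.toFinset, fun v hv => ((Set.Finite.mem_toFinset _).1 hv).1,
    fun y hy v hv hxv hyv => ?_⟩
  obtain ⟨t, ht⟩ := exists_segPoint_mem_hyperplane hxv.le hyv
  rw [Set.Finite.mem_toFinset]
  exact ⟨hv, _, ht, ⟨(t, y), ⟨trivial, hy⟩, rfl⟩⟩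

/-! ### Crossing sums: additivity and equivariance. -/

lemma finite_crossedNormals (hS : IsTotallyGeodesicHypersurface Γ S) (x y : Hyp d) :
    (crossedNormals Γ S x y).Finite := by
  obtain ⟨F, -, hF⟩ := exists_finset_forall_mem hS x (isCompact_singleton (x := y))
  exact F.finite_toSet.subset fun v hv => hF y rfl v ⟨hv.1, hv.2.1⟩ hv.2.2.1 hv.2.2.2.le

open Classical in
lemma map_crossing_eq_sum {E : Type*} [AddCommGroup E] [Module ℝ E] (L : Mink d →ₗ[ℝ] E)
    {x y : Hyp d} {F : Finset (Mink d)} (hF : ↑F ⊆ liftNormals Γ S)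
    (h : crossedNormals Γ S x y ⊆ F) :
    L (crossing Γ S x y) =
      ∑ v ∈ F, if form x.1 v < 0 ∧ 0 < form y.1 v then L v else 0 := by
  have hF' : crossedNormals Γ S x y = ↑{v ∈ F | form x.1 v < 0 ∧ 0 < form y.1 v} := by
    ext v
    rw [Finset.mem_coe, Finset.mem_filter]
    exact ⟨fun hv => ⟨h hv, hv.2.2⟩, fun hv => ⟨(hF hv.1).1, (hF hv.1).2, hv.2⟩⟩
  rw [← Finset.sum_filter, ← map_sum, crossing, hF', finsum_mem_coe_finset]

/-- The map `L` allows the endpoint z to lie on a lift, provided `L` kills its normal. It is used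
with the identity when z is off the lifts, and with `form z.1` for arbitrary z. -/
lemma map_crossing_add {E : Type*} [AddCommGroup E] [Module ℝ E] (L : Mink d →ₗ[ℝ] E)
    (hS : IsTotallyGeodesicHypersurface Γ S) {x y z : Hyp d} (hx : proj Γ x ∉ S)
    (hy : proj Γ y ∉ S) (hz : ∀ v ∈ liftNormals Γ S, form z.1 v = 0 → L v = 0) :
    L (crossing Γ S x z) = L (crossing Γ S x y) + L (crossing Γ S y z) := by
  classical
  let s := crossedNormals Γ S x z ∪ (crossedNormals Γ S x y ∪ crossedNormals Γ S y z)
  have hs : s.Finite := (finite_crossedNormals hS x z).union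
    ((finite_crossedNormals hS x y).union (finite_crossedNormals hS y z))
  let F := hs.toFinset ∪ hs.toFinset.image Neg.neg
  have hsN : s ⊆ liftNormals Γ S := by
    rintro v (hv | hv | hv) <;> exact ⟨hv.1, hv.2.1⟩
  have hF : ∀ v ∈ F, v ∈ liftNormals Γ S := by
    intro v hv
    rcases Finset.mem_union.1 hv with hv | hv
    · exact hsN (hs.mem_toFinset.1 hv)
    · obtain ⟨w, hw, rfl⟩ := Finset.mem_image.1 hv
      exact neg_mem_liftNormals (hsN (hs.mem_toFinset.1 hw))
  have hsF : s ⊆ F := fun v hv => Finset.mem_union_left _ (hs.mem_toFinset.2 hv)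
  have hneg : ∀ v, v ∈ F ↔ -v ∈ F := by
    intro v
    simp only [F, Finset.mem_union, Finset.mem_image, exists_eq_right, neg_eq_iff_eq_neg,
      neg_neg]
    tauto
  -- Over a set of normals closed under negation each lift is counted by both v and -v. This doubles
  -- the sum and makes each summand antisymmetric in the endpoints, so additivity becomes a check of
  -- signs for each v.
  have key : ∀ a b : Hyp d, crossedNormals Γ S a b ⊆ F → (2 : ℝ) • L (crossing Γ S a b) =
      ∑ v ∈ F, ((if form a.1 v < 0 ∧ 0 < form b.1 v then L v else 0) -
        if form b.1 v < 0 ∧ 0 < form a.1 v then L v else 0) := by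
    intro a b hab
    rw [two_smul, Finset.sum_sub_distrib, sub_eq_add_neg, map_crossing_eq_sum L hF hab,
      ← Finset.sum_neg_distrib]
    congr 1
    refine Finset.sum_equiv (Equiv.neg _) hneg fun v _ => ?_
    simp only [Equiv.neg_apply, form_neg_right, map_neg, Left.neg_neg_iff, Left.neg_pos_iff]
    simp only [and_comm]
    split_ifs <;> simp
  have h2 : (2 : ℝ) • L (crossing Γ S x z) =
      (2 : ℝ) • (L (crossing Γ S x y) + L (crossing Γ S y z)) := by
    rw [smul_add, key x z, key x y, key y z, ← Finset.sum_add_distrib]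
    · refine Finset.sum_congr rfl fun v hv => ?_
      by_cases h0 : form z.1 v = 0
      · simp [hz v (hF v hv) h0]
      · rcases (form_ne_zero_of_proj_notMem hx (hF v hv)).lt_or_gt with h1 | h1 <;>
        rcases (form_ne_zero_of_proj_notMem hy (hF v hv)).lt_or_gt with h2 | h2 <;>
        rcases lt_or_gt_of_ne h0 with h3 | h3 <;>
        simp [h1, h2, h3, h1.le, h2.le, h3.le, not_lt_of_ge]
    all_goals exact subset_trans (by simp [s, Set.subset_def]; tauto) hsF
  exact smul_right_injective E (two_ne_zero (α := ℝ)) h2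

lemma crossing_add (hS : IsTotallyGeodesicHypersurface Γ S) {x y z : Hyp d} (hx : proj Γ x ∉ S)
    (hy : proj Γ y ∉ S) (hz : proj Γ z ∉ S) :
    crossing Γ S x z = crossing Γ S x y + crossing Γ S y z :=
  map_crossing_add LinearMap.id hS hx hy fun _ hv h =>
    absurd h (form_ne_zero_of_proj_notMem hz hv)

lemma form_crossing_add (hS : IsTotallyGeodesicHypersurface Γ S) {x y z : Hyp d}
    (hx : proj Γ x ∉ S) (hy : proj Γ y ∉ S) :
    form z.1 (crossing Γ S x z) =
      form z.1 (crossing Γ S x y) + form z.1 (crossing Γ S y z) :=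
  map_crossing_add (formBilin d z.1) hS hx hy fun _ _ h => h

lemma form_map (A : Γ) (x y : Mink d) : form (A.1.1 x) (A.1.1 y) = form x y := A.1.2.1 x y

lemma coe_smul_hyp (A : Γ) (x : Hyp d) : (A • x).1 = A.1.1 x.1 := rfl

lemma crossedNormals_smul (A : Γ) (x y : Hyp d) :
    crossedNormals Γ S (A • x) (A • y) = A.1.1 '' crossedNormals Γ S x y := by
  have key : ∀ (A : Γ) (x y : Hyp d) (v : Mink d), v ∈ crossedNormals Γ S x y →
      A.1.1 v ∈ crossedNormals Γ S (A • x) (A • y) := by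
    rintro A x y v ⟨h1, h2, h3, h4⟩
    refine ⟨by rwa [form_map], fun z hz => ?_, by rwa [coe_smul_hyp, form_map],
      by rwa [coe_smul_hyp, form_map]⟩
    have hz' : form z.1 (A.1.1 v) = 0 := hz
    have h5 : A⁻¹ • z ∈ hyperplane v := by
      change form (A⁻¹ • z).1 v = 0
      rwa [← form_map A, ← coe_smul_hyp, smul_inv_smul]
    simpa using h2 h5
  refine Set.Subset.antisymm (fun v hv => ⟨A.1.1.symm v, ?_, by simp⟩) ?_
  · have := key A⁻¹ _ _ _ hv
    rw [inv_smul_smul, inv_smul_smul] at this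
    exact this
  · rintro _ ⟨v, hv, rfl⟩
    exact key A x y v hv

lemma crossing_smul (hS : IsTotallyGeodesicHypersurface Γ S) (A : Γ) (x y : Hyp d) :
    crossing Γ S (A • x) (A • y) = A.1.1 (crossing Γ S x y) := by
  rw [crossing, crossedNormals_smul, finsum_mem_image A.1.1.injective.injOn, crossing]
  exact ((A.1.1 : Mink d ≃ₗ[ℝ] Mink d).toLinearMap.toAddMonoidHom.map_finsum_mem _
    (finite_crossedNormals hS x y)).symm

end HypCocycle

namespace HypCocycle

open Filter Topology

variable {d : ℕ} {Γ : Subgroup (OPlus d)}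

instance : LocallyCompactSpace (Hyp d) := by
  have h1 : IsClosed {x : Mink d | form x x = -1} :=
    isClosed_eq (f := fun x : Mink d => form x x) (by fun_prop) continuous_const
  have h2 : IsOpen {x : Mink d | 0 < x (Fin.last d)} :=
    isOpen_lt (g := fun z : Mink d => z (Fin.last d)) continuous_const (by fun_prop)
  exact (h1.isLocallyClosed.inter h2.isLocallyClosed).locallyCompactSpace

instance : Nonempty (Hyp d) :=
  ⟨⟨Pi.single (Fin.last d) 1, by simp [form, Fin.castSucc_ne_last], by simp⟩⟩

lemma mem_futureCone_of_form_neg {y z : Mink d} (hy : y ∈ futureCone d) (hz : form z z < 0)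
    (h : form z y < 0) : z ∈ futureCone d := by
  refine ⟨hz, ?_⟩
  by_contra! h0
  rcases h0.lt_or_eq with h0 | h0
  · have : -z ∈ futureCone d := ⟨by simpa [form_neg_left, form_neg_right] using hz, by simpa⟩
    have := form_neg_of_mem_futureCone this hy
    rw [form_neg_left] at this
    linarith
  · have : 0 ≤ ∑ i : Fin d, z i.castSucc * z i.castSucc :=
      Finset.sum_nonneg fun _ _ => mul_self_nonneg _
    simp only [form, h0] at hz
    linarith

lemma form_add_smul_self (y : Hyp d) {q : Mink d} (hq : form q q = 1) (hqy : form q y.1 = 0)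
    (t : ℝ) : form (y.1 + t • q) (y.1 + t • q) = -1 + t ^ 2 := by
  simp only [form_add_left, form_add_right, form_smul_left, form_smul_right, y.form_self, hq, hqy,
    form_comm y.1 q]
  ring

lemma add_smul_mem_futureCone (y : Hyp d) {q : Mink d} (hq : form q q = 1)
    (hqy : form q y.1 = 0) {t : ℝ} (ht : t ^ 2 < 1) : y.1 + t • q ∈ futureCone d := by
  refine mem_futureCone_of_form_neg y.mem_futureCone ?_ ?_
  · rw [form_add_smul_self y hq hqy]; linarith
  · rw [form_add_left, form_smul_left, y.form_self, hqy]; norm_num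

/-- For a ≠ 0 the sign is stable for small t and the positive part is affine there; only a kink at 0
contributes. -/
lemma eventually_max_second_difference (a b : ℝ) : ∀ᶠ t in 𝓝 (0 : ℝ),
    max 0 (a + t * b) + max 0 (a + -t * b) - 2 * max 0 a = if a = 0 then |t * b| else 0 := by
  have h1 : Tendsto (fun t : ℝ => a + t * b) (𝓝 0) (𝓝 a) := by
    have : Continuous fun t : ℝ => a + t * b := by fun_prop
    simpa using this.tendsto 0
  have h2 : Tendsto (fun t : ℝ => a + -t * b) (𝓝 0) (𝓝 a) := by
    have : Continuous fun t : ℝ => a + -t * b := by fun_prop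
    simpa using this.tendsto 0
  rcases lt_trichotomy a 0 with ha | rfl | ha
  · filter_upwards [h1.eventually (gt_mem_nhds ha), h2.eventually (gt_mem_nhds ha)] with t h1 h2
    rw [max_eq_left h1.le, max_eq_left h2.le, max_eq_left ha.le, if_neg ha.ne]
    ring
  · refine Eventually.of_forall fun t => ?_
    rcases le_total 0 (t * b) with h | h
    · rw [abs_of_nonneg h, max_eq_right (by linarith), max_eq_left (by linarith)]; simp
    · rw [abs_of_nonpos h, max_eq_left (by linarith), max_eq_right (by linarith)]; simp
  · filter_upwards [h1.eventually (lt_mem_nhds ha), h2.eventually (lt_mem_nhds ha)] with t h1 h2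
    rw [max_eq_right h1.le, max_eq_right h2.le, max_eq_right ha.le, if_neg ha.ne']
    ring

lemma tendsto_add_neg_smul (y q : Mink d) :
    Tendsto (fun t : ℝ => y + -t • q) (𝓝 0) (𝓝 y) := by
  simpa using tendsto_add_smul y (-q)

/-! ### The potential: local formula, continuity, invariance. -/

section Potential

variable {n : ℕ} (H : Fin n → Set (HypQuotient Γ)) (ω : Fin n → ℝ) (x : Hyp d) (w : Mink d)

/-- The function on hyperbolic space that is given by the linear functional
`∑ i, ω i • crossing Γ (H i) x y + w` near each point `y` off the lifts. -/
noncomputable def potential (y : Hyp d) : ℝ :=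
  form y.1 (∑ i, ω i • crossing Γ (H i) x y + w)

open Classical in
/-- The homogeneous extension of `potential` in terms of finitely many normals. -/
noncomputable def potentialExt (F : Fin n → Finset (Mink d)) (z : Mink d) : ℝ :=
  ∑ i, ω i * (∑ v ∈ F i, if form x.1 v < 0 then max 0 (form z v) else 0) + form z w

variable {H}

lemma form_sum_smul (y w : Mink d) (c : Fin n → Mink d) :
    form y (∑ i, ω i • c i + w) = ∑ i, ω i * form y (c i) + form y w := by
  have := map_sum (formBilin d y) (fun i => ω i • c i) Finset.univ
  simp only [formBilin_apply, form_smul_right] at this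
  rw [form_add_right, this]

lemma potential_neg (y : Hyp d) : potential H (-ω) x (-w) y = -potential H ω x w y := by
  simp only [potential, Pi.neg_apply, neg_smul, Finset.sum_neg_distrib, ← neg_add, form_neg_right]

lemma continuous_potentialExt (F : Fin n → Finset (Mink d)) :
    Continuous (potentialExt ω x w F) := by
  classical
  unfold potentialExt
  refine .add (continuous_finsetSum _ fun i _ => continuous_const.mul
    (continuous_finsetSum _ fun v _ => ?_)) (by fun_prop)
  by_cases h : form x.1 v < 0
  · simp only [h, if_true]; fun_prop
  · simp only [h, if_false]; fun_prop

open Classical in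
lemma eventually_potentialExt_second_difference (F : Fin n → Finset (Mink d)) (y q : Mink d) :
    ∀ᶠ t in 𝓝 (0 : ℝ),
      potentialExt ω x w F (y + t • q) + potentialExt ω x w F (y + -t • q)
        - 2 * potentialExt ω x w F y =
      ∑ i, ω i * ∑ v ∈ F i,
        if form x.1 v < 0 ∧ form y v = 0 then |t * form q v| else 0 := by
  have h : ∀ᶠ t in 𝓝 (0 : ℝ), ∀ i, ∀ v ∈ F i,
      max 0 (form y v + t * form q v) + max 0 (form y v + -t * form q v) - 2 * max 0 (form y v) =
        if form y v = 0 then |t * form q v| else 0 :=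
    eventually_all.2 fun i => (eventually_all_finset _).2 fun v _ =>
      eventually_max_second_difference _ _
  filter_upwards [h] with t ht
  have h1 : ∀ i, (∑ v ∈ F i, if form x.1 v < 0 ∧ form y v = 0 then |t * form q v| else 0) =
      (∑ v ∈ F i, if form x.1 v < 0 then max 0 (form (y + t • q) v) else 0) +
      (∑ v ∈ F i, if form x.1 v < 0 then max 0 (form (y + -t • q) v) else 0) -
      2 * ∑ v ∈ F i, if form x.1 v < 0 then max 0 (form y v) else 0 := by
    intro i
    rw [Finset.mul_sum, ← Finset.sum_add_distrib, ← Finset.sum_sub_distrib]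
    refine Finset.sum_congr rfl fun v hv => ?_
    simp only [form_add_left, form_smul_left]
    by_cases hxv : form x.1 v < 0
    · simp only [hxv, true_and, if_true]
      exact (ht i v hv).symm
    · simp [hxv]
  simp only [potentialExt, h1, mul_sub, mul_add, Finset.sum_add_distrib, Finset.sum_sub_distrib,
    form_add_left, form_smul_left, Finset.mul_sum]
  simp only [mul_left_comm]
  ring

variable (hH : ∀ i, IsTotallyGeodesicHypersurface Γ (H i))

include hH

/-- One finite set of normals works on a whole compact neighbourhood of y. Replacing "add ⟨z,v⟩ if
the lift is crossed" by max(0, ⟨z,v⟩) gives a continuous function, homogeneous of degree one, whence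
the factor √(-⟨z,z⟩). -/
lemma exists_eventually_potentialExt_eq (y : Hyp d) :
    ∃ F : Fin n → Finset (Mink d), (∀ i, ↑(F i) ⊆ liftNormals Γ (H i)) ∧
      (∀ i, ∀ v ∈ liftNormals Γ (H i), form x.1 v < 0 → form y.1 v = 0 → v ∈ F i) ∧
      ∀ᶠ z in 𝓝 y.1, ∃ h : z ∈ futureCone d,
        potentialExt ω x w F z = √(-form z z) * potential H ω x w (toHyp ⟨z, h⟩) := by
  classical
  obtain ⟨K, hK, hyK⟩ := exists_compact_mem_nhds y
  choose F hFN hF using fun i => exists_finset_forall_mem (hH i) x hK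
  refine ⟨F, hFN, fun i v hv h1 h2 => hF i y (mem_of_mem_nhds hyK) v hv h1 h2.ge, ?_⟩
  filter_upwards [eventually_toHyp_mem hyK] with z ⟨hz, hzK⟩
  refine ⟨hz, ?_⟩
  have hpos : 0 < √(-form z z) := Real.sqrt_pos.2 (neg_pos.2 hz.1)
  have key : ∀ v, form z v = √(-form z z) * form (toHyp ⟨z, hz⟩).1 v := form_eq_sqrt_mul ⟨z, hz⟩
  have h1 : ∀ i, (∑ v ∈ F i, if form x.1 v < 0 then max 0 (form z v) else 0) =
      √(-form z z) * form (toHyp ⟨z, hz⟩).1 (crossing Γ (H i) x (toHyp ⟨z, hz⟩)) := by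
    intro i
    have h2 := map_crossing_eq_sum (formBilin d (toHyp ⟨z, hz⟩).1) (hFN i) (x := x)
      (y := toHyp ⟨z, hz⟩)
      fun v hv => hF i _ hzK v ⟨hv.1, hv.2.1⟩ hv.2.2.1 hv.2.2.2.le
    simp only [formBilin_apply] at h2
    rw [h2, Finset.mul_sum]
    refine Finset.sum_congr rfl fun v _ => ?_
    by_cases hxv : form x.1 v < 0
    · rw [if_pos hxv, key v]
      by_cases hv : 0 < form (toHyp ⟨z, hz⟩).1 v
      · rw [if_pos ⟨hxv, hv⟩, max_eq_right (by positivity)]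
      · rw [if_neg fun h => hv h.2, mul_zero, max_eq_left]
        exact mul_nonpos_of_nonneg_of_nonpos hpos.le (not_lt.1 hv)
    · simp [hxv]
  rw [potential, form_sum_smul, potentialExt, mul_add, ← key, Finset.mul_sum]
  simp only [h1, mul_left_comm]

lemma continuous_potential : Continuous (potential H ω x w) := by
  refine continuous_iff_continuousAt.2 fun y => ?_
  obtain ⟨F, -, -, hF⟩ := exists_eventually_potentialExt_eq ω x w hH y
  have h : ContinuousAt (fun u : Hyp d => potentialExt ω x w F u.1) y :=
    ((continuous_potentialExt ω x w F).comp continuous_subtype_val).continuousAt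
  refine h.congr ?_
  filter_upwards [continuous_subtype_val.continuousAt.eventually hF] with u ⟨hu, hu'⟩
  rw [hu', u.form_self, toHyp_coe]
  simp

variable {ω x w} (hx : ∀ i, proj Γ x ∉ H i)

include hx in
-- Splitting the path from x to Ay at Ax turns c(y) + w into (A w - w) + A c(y) + w = A (c(y) + w)
-- after pairing with Ay, and A preserves the form.
lemma potential_smul
    (hw : ∀ A : Γ, ∑ i, ω i • crossing Γ (H i) x (A • x) = A.1.1 w - w) (A : Γ) (y : Hyp d) :
    potential H ω x w (A • y) = potential H ω x w y := by
  have h1 : ∀ i, form (A • y).1 (crossing Γ (H i) x (A • y)) =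
      form (A • y).1 (crossing Γ (H i) x (A • x)) + form y.1 (crossing Γ (H i) x y) := by
    intro i
    rw [form_crossing_add (hH i) (hx i) (y := A • x) (by simpa using hx i), crossing_smul (hH i),
      coe_smul_hyp A y, form_map]
  have h2 := congrArg (form (A • y).1) (congrArg (· + w) (hw A))
  rw [form_sum_smul, sub_add_cancel, coe_smul_hyp A y, form_map] at h2
  rw [potential, potential, form_sum_smul, form_sum_smul]
  simp only [h1, mul_add, Finset.sum_add_distrib]
  rw [coe_smul_hyp A y]
  linarith

/-! ### Disjointness, the maximum principle, and vanishing of the weights. -/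

variable (hdisj : ∀ i j, i ≠ j → Disjoint (H i) (H j))

include hdisj

lemma eq_and_eq_or_eq_neg {i j : Fin n} {v u : Mink d} (hv : v ∈ liftNormals Γ (H i))
    (hu : u ∈ liftNormals Γ (H j)) {y : Hyp d} (hyv : y ∈ hyperplane v)
    (hyu : y ∈ hyperplane u) : j = i ∧ (u = v ∨ u = -v) := by
  have hij : j = i := by
    by_contra h
    exact Set.disjoint_left.1 (hdisj j i h) (hu.2 hyu) (hv.2 hyv)
  subst hij
  exact ⟨rfl, eq_or_eq_neg_of_mem_hyperplane (hH _) hv hu hyv hyu⟩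

/-- A lift separating x from only one of y, z would meet the segment between them, hence the
hyperplane of v. By disjointness it would equal that hyperplane, and so contain y and z. -/
lemma crossing_congr {i : Fin n} {v : Mink d} (hv : v ∈ liftNormals Γ (H i)) {y z : Hyp d}
    (hy : y ∈ hyperplane v) (hz : z ∈ hyperplane v) (j : Fin n) :
    crossing Γ (H j) x y = crossing Γ (H j) x z := by
  have key : ∀ y z : Hyp d, y ∈ hyperplane v → z ∈ hyperplane v →
      crossedNormals Γ (H j) x y ⊆ crossedNormals Γ (H j) x z := by
    rintro y z hy hz u ⟨h1, h2, h3, h4⟩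
    refine ⟨h1, h2, h3, ?_⟩
    by_contra! h5
    obtain ⟨t, ht⟩ := exists_segPoint_mem_hyperplane h5 h4.le
    have hy' : form y.1 v = 0 := hy
    obtain ⟨-, rfl | rfl⟩ := eq_and_eq_or_eq_neg hH hdisj hv ⟨h1, h2⟩
      (segPoint_mem_hyperplane hz hy t) ht
    · exact h4.ne' hy'
    · rw [form_neg_right, hy'] at h4
      simp at h4
  rw [crossing, (key y z hy hz).antisymm (key z y hz hy), crossing]

lemma potential_eq_zero_of_mem_hyperplane (hd : 2 ≤ d) {M : ℝ}
    (hM : ∀ y, |potential H ω x w y| ≤ M) {i : Fin n} {v : Mink d}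
    (hv : v ∈ liftNormals Γ (H i)) {y : Hyp d} (hy : y ∈ hyperplane v) :
    potential H ω x w y = 0 := by
  have hyv : form y.1 v = 0 := hy
  obtain ⟨q, hq, hqy, hqv⟩ := exists_unit_form_eq_zero hd y v
  set W := ∑ i, ω i • crossing Γ (H i) x y + w with hW
  have hpot : ∀ z ∈ hyperplane v, potential H ω x w z = form z.1 W := by
    intro z hz
    simp only [potential, hW, crossing_congr hH hdisj hv hz hy]
  -- The geodesic in direction q is (y + t q)/√(1 - t²), with t the hyperbolic tangent of arc
  -- length. The bound on the potential becomes a polynomial inequality, which extends to the ideal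
  -- endpoints t = ±1 and forces both ⟨y,W⟩ + ⟨q,W⟩ and ⟨y,W⟩ - ⟨q,W⟩ to vanish.
  have h1 : Set.Ioo (-1 : ℝ) 1 ⊆ {t | (form y.1 W + t * form q W) ^ 2 ≤ M ^ 2 * (1 - t ^ 2)} := by
    intro t ht
    have ht2 : t ^ 2 < 1 := by nlinarith [ht.1, ht.2]
    have hc := add_smul_mem_futureCone y hq hqy ht2
    have hz : toHyp ⟨_, hc⟩ ∈ hyperplane v := by
      refine (form_toHyp_eq_zero_iff _ _).2 ?_
      simp [form_add_left, form_smul_left, hyv, hqv]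
    have h2 := form_eq_sqrt_mul ⟨_, hc⟩ W
    rw [← hpot _ hz] at h2
    simp only [form_add_smul_self y hq hqy] at h2
    rw [form_add_left, form_smul_left] at h2
    have h3 : potential H ω x w (toHyp ⟨_, hc⟩) ^ 2 ≤ M ^ 2 :=
      sq_le_sq' (abs_le.1 (hM _)).1 (abs_le.1 (hM _)).2
    change (form y.1 W + t * form q W) ^ 2 ≤ M ^ 2 * (1 - t ^ 2)
    rw [h2, mul_pow, Real.sq_sqrt (by linarith), mul_comm]
    have : -(-1 + t ^ 2) = 1 - t ^ 2 := by ring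
    rw [this]
    exact mul_le_mul_of_nonneg_right h3 (by linarith)
  have h2 := closure_minimal h1 (isClosed_le (by fun_prop) (by fun_prop))
  rw [closure_Ioo (by norm_num)] at h2
  have h3 : (form y.1 W + 1 * form q W) ^ 2 ≤ M ^ 2 * (1 - 1 ^ 2) :=
    h2 (Set.right_mem_Icc.2 (by norm_num))
  have h4 : (form y.1 W + -1 * form q W) ^ 2 ≤ M ^ 2 * (1 - (-1) ^ 2) :=
    h2 (Set.left_mem_Icc.2 (by norm_num))
  rw [hpot y hy]
  nlinarith [sq_nonneg (form y.1 W), sq_nonneg (form q W)]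

/-- The maximum principle: a bounded potential that attains its maximum is nowhere positive. -/
lemma potential_nonpos (hd : 2 ≤ d) {M : ℝ} (hM : ∀ y, |potential H ω x w y| ≤ M) {y : Hyp d}
    (hy : ∀ z, potential H ω x w z ≤ potential H ω x w y) : potential H ω x w y ≤ 0 := by
  classical
  by_contra! hpos
  obtain ⟨F, hFN, -, hF⟩ := exists_eventually_potentialExt_eq ω x w hH y
  obtain ⟨q, hq, hqy, -⟩ := exists_unit_form_eq_zero hd y 0
  have hlt : ∀ᶠ t in 𝓝 (0 : ℝ), t ^ 2 < 1 := by
    have : Continuous fun t : ℝ => t ^ 2 := by fun_prop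
    exact this.continuousAt.eventually (gt_mem_nhds (by norm_num))
  have h := (((tendsto_add_smul y.1 q).eventually hF).and
    (((tendsto_add_neg_smul y.1 q).eventually hF).and
    ((eventually_potentialExt_second_difference ω x w F y.1 q).and hlt))).filter_mono
      (nhdsWithin_le_nhds (s := {0}ᶜ))
  obtain ⟨t, ⟨⟨hc1, h1⟩, ⟨hc2, h2⟩, h3, ht⟩, ht0⟩ := (h.and self_mem_nhdsWithin).exists
  obtain ⟨hc0, h0⟩ := hF.self_of_nhds
  -- No lift passes through y, since the potential is zero on lifts and positive here. The second
  -- difference therefore vanishes, so the values at the two points (y ± t q)/√(1 - t²) add up to 2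
  -- f(y)/√(1 - t²) > 2 f(y), against maximality.
  rw [Finset.sum_eq_zero fun i _ => ?_] at h3
  · rw [y.form_self, toHyp_coe] at h0
    simp only [neg_neg, Real.sqrt_one, one_mul] at h0
    rw [form_add_smul_self y hq hqy] at h1 h2
    rw [h1, h2, h0, neg_sq] at h3
    have ht0 : 0 < t ^ 2 := by
      have : t ≠ 0 := ht0
      positivity
    have hs : √(-(-1 + t ^ 2)) < 1 := by
      rw [Real.sqrt_lt' one_pos]; linarith
    have hs0 := Real.sqrt_nonneg (-(-1 + t ^ 2))
    have h4 := mul_le_mul_of_nonneg_left (hy (toHyp ⟨_, hc1⟩)) hs0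
    have h5 := mul_le_mul_of_nonneg_left (hy (toHyp ⟨_, hc2⟩)) hs0
    nlinarith
  · rw [Finset.sum_eq_zero fun v hv => if_neg fun h => ?_, mul_zero]
    exact hpos.ne' (potential_eq_zero_of_mem_hyperplane hH hdisj hd hM (hFN i hv) h.2)

include hx in
lemma potential_eq_zero (hd : 2 ≤ d) [CompactSpace (HypQuotient Γ)]
    (hw : ∀ A : Γ, ∑ i, ω i • crossing Γ (H i) x (A • x) = A.1.1 w - w) (y : Hyp d) :
    potential H ω x w y = 0 := by
  have hcont : ∀ (ω : Fin n → ℝ) (w : Mink d),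
      (∀ A : Γ, ∑ i, ω i • crossing Γ (H i) x (A • x) = A.1.1 w - w) →
      ∃ y, ∀ z, potential H ω x w z ≤ potential H ω x w y := by
    intro ω w hw
    have hinv : ∀ a b : Hyp d, MulAction.orbitRel Γ (Hyp d) a b →
        potential H ω x w a = potential H ω x w b := by
      rintro a b ⟨A, rfl⟩
      exact potential_smul hH hx hw A b
    have hc : Continuous (Quotient.lift (potential H ω x w) hinv : HypQuotient Γ → ℝ) :=
      (continuous_potential ω x w hH).quotient_lift hinv
    obtain ⟨a, -, ha⟩ := isCompact_univ.exists_isMaxOn ⟨proj Γ x, trivial⟩ hc.continuousOn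
    obtain ⟨y, rfl⟩ := Quotient.exists_rep a
    exact ⟨y, fun z => ha (Set.mem_univ (proj Γ z))⟩
  have hw' : ∀ A : Γ, ∑ i, (-ω) i • crossing Γ (H i) x (A • x) = A.1.1 (-w) - -w := by
    intro A
    simp only [Pi.neg_apply, neg_smul, Finset.sum_neg_distrib, hw A, map_neg]
    abel
  obtain ⟨y₁, h1⟩ := hcont ω w hw
  obtain ⟨y₂, h2⟩ := hcont (-ω) (-w) hw'
  have hM : ∀ y, |potential H ω x w y| ≤
      max (potential H ω x w y₁) (potential H (-ω) x (-w) y₂) := by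
    intro y
    have h3 := h2 y
    rw [potential_neg] at h3
    exact abs_le'.2 ⟨(h1 y).trans (le_max_left _ _), h3.trans (le_max_right _ _)⟩
  have hM' : ∀ y, |potential H (-ω) x (-w) y| ≤
      max (potential H ω x w y₁) (potential H (-ω) x (-w) y₂) := by
    intro y
    rw [potential_neg, abs_neg]
    exact hM y
  have h3 := (h1 y).trans (potential_nonpos hH hdisj hd hM h1)
  have h4 := (h2 y).trans (potential_nonpos hH hdisj hd hM' h2)
  rw [potential_neg] at h4
  linarith

include hx in
/-- A non-trivially weighted potential is bent along the lifts, hence does not vanish. -/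
lemma weight_eq_zero_of_potential_eq_zero (h : ∀ y, potential H ω x w y = 0) : ω = 0 := by
  classical
  funext i
  obtain ⟨s, hs⟩ := (hH i).nonempty
  obtain ⟨y, rfl⟩ := Quotient.exists_rep s
  obtain ⟨v, hv, hyv, hxv⟩ : ∃ v ∈ liftNormals Γ (H i), y ∈ hyperplane v ∧ form x.1 v < 0 := by
    obtain ⟨v, hv, hyv⟩ := exists_mem_liftNormals (hH i) hs
    rcases (form_ne_zero_of_proj_notMem (hx i) hv).lt_or_gt with h | h
    · exact ⟨v, hv, hyv, h⟩
    · exact ⟨-v, neg_mem_liftNormals hv, by rwa [hyperplane_neg], by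
        rw [form_neg_right]; linarith⟩
  obtain ⟨F, hFN, hFv, hF⟩ := exists_eventually_potentialExt_eq ω x w hH y
  have h' := (((tendsto_add_smul y.1 v).eventually hF).and
    (((tendsto_add_neg_smul y.1 v).eventually hF).and
    (eventually_potentialExt_second_difference ω x w F y.1 v))).filter_mono
      (nhdsWithin_le_nhds (s := {0}ᶜ))
  obtain ⟨t, ⟨⟨hc1, h1⟩, ⟨hc2, h2⟩, h3⟩, ht0⟩ := (h'.and self_mem_nhdsWithin).exists
  obtain ⟨hc0, h0⟩ := hF.self_of_nhds
  have hu : ∀ j, ∀ u ∈ F j, form x.1 u < 0 ∧ form y.1 u = 0 → j = i ∧ u = v := by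
    intro j u hu hxu
    obtain ⟨hj, rfl | rfl⟩ := eq_and_eq_or_eq_neg hH hdisj hv (hFN j hu) hyv hxu.2
    · exact ⟨hj, rfl⟩
    · have := hxu.1
      rw [form_neg_right] at this
      linarith
  -- Moving in the normal direction v, only v itself contributes to the second difference, which
  -- reads 0 = `ω i` |t|.
  rw [h1, h2, h0, h, h, h, Finset.sum_eq_single i, Finset.sum_eq_single v,
    if_pos ⟨hxv, hyv⟩, hv.1] at h3
  · simpa [show t ≠ 0 from ht0] using h3.symm
  · exact fun u hu' huv => if_neg fun hxu => huv (hu i u hu' hxu).2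
  · exact fun h => absurd (hFv i v hv hxv hyv) h
  · intro j _ hj
    rw [Finset.sum_eq_zero fun u hu' => if_neg fun hxu => hj (hu j u hu' hxu).1, mul_zero]
  · exact fun h => absurd (Finset.mem_univ i) h

/-- The hypersurfaces do not cover the quotient. -/
lemma exists_forall_proj_notMem : ∃ x : Hyp d, ∀ i, proj Γ x ∉ H i := by
  by_contra! hcov
  obtain ⟨y⟩ : Nonempty (Hyp d) := inferInstance
  obtain ⟨i, hi⟩ := hcov y
  obtain ⟨v, hv, hyv, U, hU, h⟩ := (hH i).exists_nhds hi
  have h1 : ∀ᶠ z in 𝓝 y, ∀ j, j ≠ i → proj Γ z ∉ H j :=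
    eventually_all.2 fun j => eventually_imp_distrib_left.2 fun hj =>
      ((hH j).isClosed.preimage continuous_proj).isOpen_compl.mem_nhds fun hyj =>
        Set.disjoint_left.1 (hdisj j i hj) hyj hi
  -- Pushing y along the normal v leaves the only hypersurface nearby.
  have h2 := ((tendsto_add_smul y.1 v).eventually
    (eventually_toHyp_mem (inter_mem hU h1))).filter_mono (nhdsWithin_le_nhds (s := {0}ᶜ))
  obtain ⟨t, ⟨hc, hzU, hz⟩, ht0⟩ := (h2.and self_mem_nhdsWithin).exists
  obtain ⟨j, hj⟩ := hcov (toHyp ⟨_, hc⟩)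
  by_cases hji : j = i
  · subst hji
    have h3 := (form_toHyp_eq_zero_iff _ _).1 (h.subset ⟨hj, hzU⟩).1
    have hyv : form y.1 v = 0 := hyv
    simp only [form_add_left, form_smul_left, hyv, hv, zero_add, mul_one] at h3
    exact ht0 h3
  · exact hz j hji hj

end Potential

end HypCocycle

namespace HypCocycle

variable {d : ℕ} {Γ : Subgroup (OPlus d)} {n : ℕ} {H : Fin n → Set (HypQuotient Γ)}

/-! ### The cocycle and injectivity into cohomology. -/

/-- The cocycle of weighted crossings, as a linear function of the weights. -/
noncomputable def crossingCocycle (hH : ∀ i, IsTotallyGeodesicHypersurface Γ (H i)) {x : Hyp d}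
    (hx : ∀ i, proj Γ x ∉ H i) :
    (Fin n → ℝ) →ₗ[ℝ] groupCohomology.cocycles₁ (minkRep Γ) :=
  LinearMap.codRestrict _
    (LinearMap.pi fun A : Γ => Fintype.linearCombination ℝ fun i => crossing Γ (H i) x (A • x))
    fun ω => by
      refine (groupCohomology.mem_cocycles₁_iff (A := minkRep Γ) _).2 fun A B => ?_
      change ∑ i, ω i • crossing Γ (H i) x ((A * B) • x) =
        A.1.1 (∑ i, ω i • crossing Γ (H i) x (B • x)) + ∑ i, ω i • crossing Γ (H i) x (A • x)
      rw [map_sum, ← Finset.sum_add_distrib]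
      refine Finset.sum_congr rfl fun i _ => ?_
      -- The path from x to ABx is split at Ax; its second half is the A-translate of the path from
      -- x to Bx.
      rw [map_smul, ← crossing_smul (hH i), ← smul_add, smul_smul,
        crossing_add (hH i) (hx i) (y := A • x) (by simpa using hx i) (by simpa using hx i)]
      exact congrArg _ (add_comm _ _)

lemma crossingCocycle_apply (hH : ∀ i, IsTotallyGeodesicHypersurface Γ (H i)) {x : Hyp d}
    (hx : ∀ i, proj Γ x ∉ H i) (ω : Fin n → ℝ) (A : Γ) :
    (crossingCocycle hH hx ω : Γ → Mink d) A = ∑ i, ω i • crossing Γ (H i) x (A • x) := rfl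

lemma injective_H1π_crossingCocycle (hd : 2 ≤ d) [CompactSpace (HypQuotient Γ)]
    (hH : ∀ i, IsTotallyGeodesicHypersurface Γ (H i))
    (hdisj : ∀ i j, i ≠ j → Disjoint (H i) (H j)) {x : Hyp d} (hx : ∀ i, proj Γ x ∉ H i) :
    Function.Injective
      ((groupCohomology.H1π (minkRep Γ)).hom ∘ₗ crossingCocycle hH hx) := by
  refine (injective_iff_map_eq_zero _).2 fun ω hω => ?_
  obtain ⟨w, hw⟩ := (groupCohomology.H1π_eq_zero_iff (crossingCocycle hH hx ω)).1 hω
  have hw' : ∀ A : Γ, ∑ i, ω i • crossing Γ (H i) x (A • x) = A.1.1 w - w := fun A =>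
    (congrFun hw A).symm
  exact weight_eq_zero_of_potential_eq_zero hH hx hdisj (potential_eq_zero hH hx hdisj hd hw')

end HypCocycle

theorem mainTheorem9 (d : ℕ) (hd : 2 ≤ d)
    (Γ : Subgroup (HypCocycle.OPlus d)) (hΓ : HypCocycle.IsCompactHyperbolicManifold Γ)
    (n : ℕ) (H : Fin n → Set (HypCocycle.HypQuotient Γ))
    (hH : ∀ i, HypCocycle.IsTotallyGeodesicHypersurface Γ (H i))
    (hdisj : ∀ i j, i ≠ j → Disjoint (H i) (H j)) :
    (n : Cardinal) ≤ Module.rank ℝ (groupCohomology.H1 (HypCocycle.minkRep Γ)) ∧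
    ∀ x : HypCocycle.Hyp d, (∀ i, HypCocycle.proj Γ x ∉ H i) →
      ∃ τ : (Fin n → ℝ) →ₗ[ℝ] groupCohomology.cocycles₁ (HypCocycle.minkRep Γ),
        (∀ (ω : Fin n → ℝ) (A : Γ),
          (τ ω : Γ → HypCocycle.Mink d) A =
            ∑ i, ω i • HypCocycle.crossing Γ (H i) x (A • x)) ∧
        Function.Injective
          (fun ω : Fin n → ℝ => groupCohomology.H1π (HypCocycle.minkRep Γ) (τ ω)) := by
  have := hΓ.compact
  refine ⟨?_, fun x hx => ⟨HypCocycle.crossingCocycle hH hx,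
    HypCocycle.crossingCocycle_apply hH hx,
    HypCocycle.injective_H1π_crossingCocycle hd hH hdisj hx⟩⟩
  obtain ⟨x, hx⟩ := HypCocycle.exists_forall_proj_notMem hH hdisj
  have h := LinearMap.rank_le_of_injective _
    (HypCocycle.injective_H1π_crossingCocycle hd hH hdisj hx)
  rwa [rank_fin_fun] at h
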